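/- Let $X$ be a random variable with values in an alphabet $\mathcal X=\{x_1,\dots,x_n\}$ of $n$ elements, and let $p_1\ge p_2\ge\dots\ge p_n\ge 0$ be the probabilities $P\{X=x\}$, $x\in\mathcal X$, listed in non-increasing order; write $\mathbf p=(p_1,\dots,p_n)$. Let $2\le m<n$, let $\mathcal Y_m$ be a set of $m$ elements, and let $\mathcal F_m$ be the set of all surjective functions $f:\mathcal X\to\mathcal Y_m$. Let $\log$ be the logarithm in base $2$ and $\ln$ the natural logarithm. For a probability vector $\mathbf a=(a_1,\dots,a_t)$ put $H(\mathbf a)=-\sum_i a_i\log a_i$ (with $0\log 0=0$), and for a random variable $Z$ with finitely many values let $H(Z)$ be $H$ of its distribution. Define $R_m(\mathbf p)=(r_1,\dots,r_m)$ as follows. If $p_1<1/m$, then $r_i=1/m$ for all $i$. If $p_1\ge 1/m$, let $i^*$ be the largest index $i\in\{1,\dots,m-1\}$ such that $p_i\ge\frac{1}{m-i}\sum_{j=i+1}^n p_j$ (the index $i=1$ satisfies this), and put $$r_i=\begin{cases}p_i & \text{for } i=1,\dots,i^*,\\ \dfrac{1}{m-i^*}\displaystyle\sum_{j=i^*+1}^n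 p_j & \text{for } i=i^*+1,\dots,m.\end{cases}$$ Define $Q_m(\mathbf p)=(q_1,\dots,q_m)$ by $q_1=\sum_{k=1}^{n-m+1}p_k$ and $q_i=p_{n-m+i}$ for $i=2,\dots,m$. Then $$\max_{f\in\mathcal F_m}H(f(X))\in\bigl[H(R_m(\mathbf p))-\alpha,\;H(R_m(\mathbf p))\bigr],\qquad \alpha=1-\frac{1+\ln(\ln 2)}{\ln 2}<0.0861,$$ and $$\min_{f\in\mathcal F_m}H(f(X))=H(Q_m(\mathbf p)).$$ -/

import Mathlib

noncomputable section

namespace EntropyOfFunction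

/-- Shannon entropy in bits of a finite family of masses; `Real.logb 2 0 = 0`, so a zero mass
contributes `0`. -/
def entropy {ι : Type*} [Fintype ι] (a : ι → ℝ) : ℝ :=
  -∑ i, a i * Real.logb 2 (a i)

/-- The probability mass function of a finite-valued random variable `Z`. -/
def law {Ω : Type*} [MeasurableSpace Ω] (P : MeasureTheory.Measure Ω) {E : Type*} (Z : Ω → E) :
    E → ℝ :=
  fun e => P.real (Z ⁻¹' {e})

/-- The non-increasing rearrangement of a vector. -/
def decr {n : ℕ} (p : Fin n → ℝ) : Fin n → ℝ :=
  p ∘ Tuple.sort (OrderDual.toDual ∘ p)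

theorem decr_antitone {n : ℕ} (p : Fin n → ℝ) : Antitone (decr p) :=
  fun _ _ h => Tuple.monotone_sort (OrderDual.toDual ∘ p) h

/-- The coordinate `p_i` with indices starting from `1`, for `1 ≤ i ≤ n`
(and `0` for other `i`). -/
def coord {n : ℕ} (p : Fin n → ℝ) (i : ℕ) : ℝ :=
  if h : 1 ≤ i ∧ i ≤ n then p ⟨i - 1, by omega⟩ else 0

/-- The tail sum `p_{i+1} + ⋯ + p_n`. -/
def tailSum {n : ℕ} (p : Fin n → ℝ) (i : ℕ) : ℝ :=
  ∑ j ∈ Finset.Icc (i + 1) n, coord p j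

/-- The largest index `i ∈ {1, …, m - 1}` with `p_i ≥ (p_{i+1} + ⋯ + p_n) / (m - i)`
(and `0` if there is none). -/
def cutIndex (m : ℕ) {n : ℕ} (p : Fin n → ℝ) : ℕ :=
  Nat.findGreatest (fun i => tailSum p i / ((m : ℝ) - (i : ℝ)) ≤ coord p i) (m - 1)

/-- The flattening operator `R_m` on a non-increasing probability vector `p`. The component with
1-based index `i` of the result stands at position `i - 1` of `Fin m`. -/
def flatten (m : ℕ) {n : ℕ} (p : Fin n → ℝ) : Fin m → ℝ := fun k =>
  if coord p 1 < 1 / (m : ℝ) then 1 / (m : ℝ)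
  else if (k : ℕ) + 1 ≤ cutIndex m p then coord p (k + 1)
  else tailSum p (cutIndex m p) / ((m : ℝ) - (cutIndex m p : ℝ))

/-- The operator `Q_m` on a non-increasing probability vector `p`: the first component is
`p_1 + ⋯ + p_{n-m+1}`, and the `i`-th one is `p_{n-m+i}` for `i = 2, …, m`. -/
def mergeTop (m : ℕ) {n : ℕ} (p : Fin n → ℝ) : Fin m → ℝ := fun k =>
  if (k : ℕ) = 0 then ∑ j ∈ Finset.Icc 1 (n - m + 1), coord p j
  else coord p (n - m + (k + 1))

/-- The constant `1 - (1 + ln ln 2) / ln 2`. -/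
def alpha : ℝ := 1 - (1 + Real.log (Real.log 2)) / Real.log 2

/-- The values `H(f(X))`, where `f` ranges over the surjections from `E` onto `F`. -/
def imageEntropies {Ω : Type*} [MeasurableSpace Ω] (P : MeasureTheory.Measure Ω)
    {E : Type*} (X : Ω → E) (F : Type*) [Fintype F] : Set ℝ :=
  {h | ∃ f : E → F, Function.Surjective f ∧ h = entropy (law P (f ∘ X))}

end EntropyOfFunction

end

noncomputable section

namespace EntropyOfFunction

open Real Finset

/-! ### Scalar inequalities -/

/-! After sorting, `H(f(X))` is the entropy of the fibre masses `push p f`, and all estimates are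
made in nats with `negMulLog`. Upper bound: the flattening is a water level `c` replacing the tail
of `p`. Gibbs' inequality for the fibre masses is applied against `max (p i) c` at one maximizing
representative per fibre; these `m` numbers sum to at most 1 (`IsLevel.sum_negMulLog_push_le`).
Lower bound: let `f` be a maximizer and `y` its least fibre mass. A fibre heavier than `2 * y`
carries at most one positive mass, since otherwise moving a point to the lightest fibre gains
entropy. Such masses are entries of the flattening too, so they cancel. The other fibres have masses
in `[y, 2 * y]`, where the chord of `negMulLog` shows a loss of at most `alpha` bits against the
uniform vector (`IsLevel.le_sum_negMulLog_push`). Minimum: each fibre other than the heaviest has a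
representative at least as heavy as the matching entry of `Q`. Moving the excess to the heaviest
fibre lowers the cross entropy, and Gibbs' inequality finishes (`sum_negMulLog_mergeTop_le`). -/

theorem alpha_lt : alpha < 0.0861 := by
  have h1 := Real.log_two_gt_d9
  have h2 := Real.log_two_lt_d9
  have hpos : 0 < Real.log 2 := by linarith
  -- As `1 / log 2 < 1.442698`, seven Taylor terms of `exp` suffice to bound `log (log 2)` from
  -- below.
  have hexp : (1.442698 : ℝ) ≤ Real.exp 0.366532 := by
    have h := Real.sum_le_exp_of_nonneg (x := 0.366532) (by norm_num) 7
    refine le_trans ?_ h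
    norm_num [Finset.sum_range_succ, Nat.factorial]
  have hinv : (Real.log 2)⁻¹ ≤ Real.exp 0.366532 := by
    refine le_trans ?_ hexp
    rw [inv_le_comm₀ hpos (by norm_num)]
    refine le_trans ?_ h1.le
    norm_num
  have hlog : -0.366532 ≤ Real.log (Real.log 2) := by
    have h := Real.log_le_log (inv_pos.2 hpos) hinv
    rw [Real.log_exp, Real.log_inv] at h
    linarith
  have hdiv : 0.9139 < (1 + Real.log (Real.log 2)) / Real.log 2 := by
    rw [lt_div_iff₀ hpos]
    linarith
  unfold alpha
  linarith

/-- The right side is the maximum over `u > 0` of `log u + 2 * (1 - u) * log 2`, attained at `u = 1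
/ (2 * log 2)`; this is how `alpha` arises. -/
theorem alpha_mul_log_two :
    alpha * Real.log 2 = 2 * Real.log 2 - 1 - Real.log (2 * Real.log 2) := by
  have hpos : 0 < Real.log 2 := Real.log_pos (by norm_num)
  rw [Real.log_mul (by norm_num) hpos.ne', alpha]
  field_simp
  ring

theorem alpha_mul_log_two_nonneg : 0 ≤ alpha * Real.log 2 := by
  have hpos : 0 < Real.log 2 := Real.log_pos (by norm_num)
  have h := Real.log_le_sub_one_of_pos (mul_pos two_pos hpos)
  rw [alpha_mul_log_two]
  linarith

/-- The tangent line of `negMulLog` at `s` lies above its graph. -/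
theorem negMulLog_le_tangent {t s : ℝ} (ht : 0 ≤ t) (hs : 0 ≤ s) (h : s = 0 → t = 0) :
    negMulLog t ≤ -(t * Real.log s) + (s - t) := by
  rcases ht.eq_or_lt with rfl | ht
  · simpa using hs
  have hs' : 0 < s := hs.lt_of_ne fun h0 => ht.ne' (h h0.symm)
  have h1 := Real.log_le_sub_one_of_pos (div_pos hs' ht)
  rw [Real.log_div hs'.ne' ht.ne'] at h1
  have h2 := mul_le_mul_of_nonneg_left h1 ht.le
  have h3 : t * (s / t - 1) = s - t := by field_simp
  rw [negMulLog]
  nlinarith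

/-- The chord of `negMulLog` over `[y, 2 * y]` lies below its graph. -/
theorem chord_le_negMulLog {y t : ℝ} (hy : 0 < y) (h1 : y ≤ t) (h2 : t ≤ 2 * y) :
    -(t * Real.log y) - 2 * (t - y) * Real.log 2 ≤ negMulLog t := by
  have hc := (@Real.concaveOn_negMulLog).2 (Set.mem_Ici.2 hy.le)
    (Set.mem_Ici.2 (by linarith : 0 ≤ 2 * y))
    (by rw [sub_nonneg, div_le_iff₀ hy]; exact h2 : 0 ≤ 2 - t / y)
    (by rw [sub_nonneg, le_div_iff₀ hy]; linarith : 0 ≤ t / y - 1) (by ring)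
  have ht : (2 - t / y) • y + (t / y - 1) • (2 * y) = t := by
    simp only [smul_eq_mul]; field_simp; ring
  rw [ht] at hc
  refine le_trans (le_of_eq ?_) hc
  simp only [smul_eq_mul, negMulLog]
  rw [Real.log_mul two_ne_zero hy.ne']
  field_simp
  ring

/-- Moving mass from the larger to the smaller of two numbers increases the sum of `negMulLog`. -/
theorem negMulLog_transfer_lt {x z e : ℝ} (hz : 0 ≤ z) (he : 0 < e) (h : z + e < x) :
    negMulLog x + negMulLog z < negMulLog (x - e) + negMulLog (z + e) := by
  have hd : 0 < x - z := by linarith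
  have key : ∀ a b : ℝ, 0 < a → 0 < b → a + b = 1 →
      a * negMulLog x + b * negMulLog z < negMulLog (a * x + b * z) := fun a b ha hb hab =>
    Real.strictConcaveOn_negMulLog.2 (Set.mem_Ici.2 (by linarith)) (Set.mem_Ici.2 hz)
      (by linarith : z < x).ne' ha hb hab
  have ha : 0 < e / (x - z) := div_pos he hd
  have hb : 0 < 1 - e / (x - z) := by
    rw [sub_pos, div_lt_one hd]; linarith
  have k1 := key _ _ ha hb (by ring)
  have k2 := key _ _ hb ha (by ring)
  -- The two new masses are convex combinations of `x` and `z` with exchanged weights, so adding the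
  -- two concavity inequalities restores total weight one on each.
  have e1 : e / (x - z) * x + (1 - e / (x - z)) * z = z + e := by
    field_simp; ring
  have e2 : (1 - e / (x - z)) * x + e / (x - z) * z = x - e := by
    field_simp; ring
  rw [e1] at k1
  rw [e2] at k2
  nlinarith

theorem entropy_eq_sum_negMulLog {ι : Type*} [Fintype ι] (a : ι → ℝ) :
    entropy a = (∑ i, negMulLog (a i)) / Real.log 2 := by
  simp only [entropy, Real.logb, negMulLog, Finset.sum_div, ← Finset.sum_neg_distrib]
  exact Finset.sum_congr rfl fun i _ => by ring

/-! ### Push-forward of a finite vector -/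

open Classical in
/-- The vector of the masses of the fibres of `f`. -/
def push {ι F : Type*} [Fintype ι] (p : ι → ℝ) (f : ι → F) (y : F) : ℝ :=
  ∑ i, if f i = y then p i else 0

section Push

variable {ι F : Type*} [Fintype ι] {p : ι → ℝ}

theorem push_eq_sum_filter [DecidableEq F] (p : ι → ℝ) (f : ι → F) (y : F) :
    push p f y = ∑ i with f i = y, p i := by
  rw [push, Finset.sum_filter]
  exact Finset.sum_congr rfl fun i _ => by split_ifs <;> rfl

theorem push_nonneg (hp : ∀ i, 0 ≤ p i) (f : ι → F) (y : F) : 0 ≤ push p f y :=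
  Finset.sum_nonneg fun i _ => by split_ifs <;> simp [hp]

theorem le_push (hp : ∀ i, 0 ≤ p i) (f : ι → F) (i : ι) : p i ≤ push p f (f i) := by
  classical
  have h := Finset.single_le_sum (f := fun j => if f j = f i then p j else 0)
    (fun j _ => by split_ifs <;> simp [hp]) (Finset.mem_univ i)
  simpa [push] using h

/-- Change of variables, which turns cross entropies over fibres into sums over points. -/
theorem sum_push_mul [Fintype F] (p : ι → ℝ) (f : ι → F) (G : F → ℝ) :
    ∑ y, push p f y * G y = ∑ i, p i * G (f i) := by
  classical
  simp only [push, Finset.sum_mul]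
  rw [Finset.sum_comm]
  refine Finset.sum_congr rfl fun i _ => ?_
  rw [Finset.sum_eq_single (f i)] <;> simp +contextual [eq_comm]

theorem sum_push [Fintype F] (p : ι → ℝ) (f : ι → F) : ∑ y, push p f y = ∑ i, p i := by
  simpa using sum_push_mul p f fun _ => 1

theorem push_update [DecidableEq ι] [DecidableEq F] (p : ι → ℝ) (f : ι → F) (i : ι) (b y : F) :
    push p (Function.update f i b) y =
      push p f y - (if f i = y then p i else 0) + (if b = y then p i else 0) := by
  classical
  simp only [push]
  rw [← Finset.add_sum_erase _ _ (Finset.mem_univ i),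
    ← Finset.add_sum_erase univ (fun j => @ite _ (f j = y) (Classical.propDecidable _) (p j) 0)
      (Finset.mem_univ i)]
  rw [Finset.sum_congr rfl fun j hj => by
    rw [Function.update_of_ne (Finset.ne_of_mem_erase hj)], Function.update_self]
  split_ifs <;> ring

theorem push_eq_of_forall_eq_zero {f : ι → F} {i : ι}
    (h : ∀ j, j ≠ i → f j = f i → p j = 0) : push p f (f i) = p i := by
  classical
  rw [push, Finset.sum_eq_single i]
  · simp
  · intro j _ hj
    split_ifs with hf
    · exact h j hj hf
    · rfl
  · simp

theorem push_comp_equiv {G : Type*} (p : ι → ℝ) (f : ι → F) (e : F ≃ G) (y : F) :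
    push p (e ∘ f) (e y) = push p f y := by
  refine Finset.sum_congr rfl fun i _ => ?_
  by_cases h : f i = y <;> simp [h]

theorem push_comp_perm (p : ι → ℝ) (f : ι → F) (e : Equiv.Perm ι) :
    push (p ∘ e) (f ∘ e) = push p f := by
  funext y
  exact Equiv.sum_comp e fun i => @ite _ (f i = y) (Classical.propDecidable _) (p i) 0

end Push

/-! ### Entropy maximizing functions -/

/-- If `f` maximizes the entropy, then a fibre with more than twice the mass of another one
contains at most one element of positive mass. -/
theorem eq_of_two_mul_push_lt {ι F : Type*} [Fintype ι] [Fintype F] {p : ι → ℝ}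
    (hp : ∀ i, 0 ≤ p i) {f : ι → F} (hf : Function.Surjective f)
    (hmax : ∀ g : ι → F, Function.Surjective g →
      ∑ y, negMulLog (push p g y) ≤ ∑ y, negMulLog (push p f y))
    {b : F} {i j : ι} (hij : f i = f j) (hb : 2 * push p f b < push p f (f i))
    (hi : 0 < p i) (hj : 0 < p j) : i = j := by
  classical
  by_contra hne
  -- The lighter point has at most half of its fibre's mass, so moving it to `b` leaves `b` lighter
  -- than the old fibre was. The other point keeps the map surjective.
  wlog hle : p i ≤ p j generalizing i j
  · exact this hij.symm (hij ▸ hb) hj hi (Ne.symm hne) (le_of_not_ge hle)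
  have hbn := push_nonneg hp f b
  have hab : f i ≠ b := by
    rintro h
    rw [h] at hb
    linarith
  have hsum : p i + p j ≤ push p f (f i) := by
    have h := Finset.sum_le_sum_of_subset_of_nonneg (Finset.subset_univ ({i, j} : Finset ι))
      (f := fun l => if f l = f i then p l else 0)
      (fun l _ _ => by split_ifs <;> simp [hp])
    rw [Finset.sum_pair hne] at h
    simpa [push, hij] using h
  have hsurj : Function.Surjective (Function.update f i b) := by
    intro y
    obtain ⟨l, rfl⟩ := hf y
    by_cases hl : l = i
    · exact ⟨j, by rw [Function.update_of_ne (Ne.symm hne), hl, hij]⟩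
    · exact ⟨l, by rw [Function.update_of_ne hl]⟩
  have hm := hmax _ hsurj
  rw [← sub_nonneg, ← Finset.sum_sub_distrib, Fintype.sum_eq_add (f i) b hab] at hm
  · simp only [push_update, if_true, if_neg hab, if_neg hab.symm, add_zero, sub_zero] at hm
    have := negMulLog_transfer_lt hbn hi
      (x := push p f (f i)) (by linarith)
    linarith
  · rintro y ⟨h1, h2⟩
    simp [push_update, h1.symm, h2.symm]

/-! ### The water level -/

/-- The vector `R` with entries `p i` for `i < k` and `m - k` entries equal to `c`
is the flattening of `p`. -/
structure IsLevel (m : ℕ) {n : ℕ} (p : Fin n → ℝ) (k : ℕ) (c : ℝ) : Prop where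
  lt : k < m
  level_le : ∀ i : Fin n, (i : ℕ) < k → c ≤ p i
  le_level : ∀ i : Fin n, k ≤ (i : ℕ) → p i ≤ c
  tail : ∑ i : Fin n with k ≤ Fin.val i, p i = ((m : ℝ) - k) * c

theorem card_filter_lt {n k : ℕ} (hk : k ≤ n) : #{i : Fin n | (i : ℕ) < k} = k := by
  have := Fin.card_filter_val_lt (n := n) (m := k)
  simpa [hk] using this

section Level

variable {n m : ℕ} {p : Fin n → ℝ} {k : ℕ} {c : ℝ} {F : Type*} [Fintype F]

theorem IsLevel.nonneg (h : IsLevel m p k c) (hp : ∀ i, 0 ≤ p i) : 0 ≤ c := by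
  have h1 : (0 : ℝ) < (m : ℝ) - k := sub_pos.2 (by exact_mod_cast h.lt)
  have h2 : 0 ≤ ∑ i : Fin n with k ≤ Fin.val i, p i := Finset.sum_nonneg fun i _ => hp i
  rw [h.tail] at h2
  exact nonneg_of_mul_nonneg_right h2 h1

theorem sum_head_add_tail (G : Fin n → ℝ) (k : ℕ) :
    ∑ i : Fin n with Fin.val i < k, G i + ∑ i : Fin n with k ≤ Fin.val i, G i = ∑ i, G i := by
  rw [← Finset.sum_filter_add_sum_filter_not univ (fun i : Fin n => (i : ℕ) < k)]
  simp only [not_lt]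

/-- No image of `p` on `m` points has larger entropy than the flattening of `p`. -/
theorem IsLevel.sum_negMulLog_push_le (h : IsLevel m p k c) (hmn : m < n) (hp : ∀ i, 0 ≤ p i)
    (hF : Fintype.card F = m) {f : Fin n → F} (hf : Function.Surjective f) :
    ∑ y, negMulLog (push p f y) ≤
      ∑ i : Fin n with Fin.val i < k, negMulLog (p i) + ((m : ℝ) - k) * negMulLog c := by
  classical
  have hc := h.nonneg hp
  -- This is `max (p i) c`.
  set w : Fin n → ℝ := fun i => if (i : ℕ) < k then p i else c with hw
  have hwc : ∀ i, c ≤ w i := fun i => by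
    simp only [hw]; split_ifs with hi
    · exact h.level_le i hi
    · exact le_rfl
  have hpw : ∀ i, p i ≤ w i := fun i => by
    simp only [hw]; split_ifs with hi
    · exact le_rfl
    · exact h.le_level i (not_lt.1 hi)
  have hmax : ∀ y : F, ∃ a, f a = y ∧ ∀ i, f i = y → w i ≤ w a := by
    intro y
    obtain ⟨a, ha, ha'⟩ := Finset.exists_max_image ({i | f i = y} : Finset (Fin n)) w
      ((hf y).imp fun i hi => by simpa using hi)
    exact ⟨a, by simpa using ha, fun i hi => ha' i (by simpa using hi)⟩
  choose a ha hawm using hmax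
  have hinj : Function.Injective a := fun y z hyz => by rw [← ha y, ← ha z, hyz]
  -- The excess `w - c` is nonnegative and vanishes from index `k` on, so any `m` distinct indices
  -- have total at most the head sum plus `(m - k) * c`.
  have hsum : ∑ y, w (a y) ≤ ∑ i, p i := by
    have e1 : ∑ y, w (a y) = ∑ i ∈ univ.image a, (w i - c) + m * c := by
      rw [Finset.sum_image fun x _ y _ hxy => hinj hxy, Finset.sum_sub_distrib]
      simp [hF]
    have e2 : ∑ i ∈ univ.image a, (w i - c) ≤ ∑ i, (w i - c) :=
      Finset.sum_le_sum_of_subset_of_nonneg (Finset.subset_univ _)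
        fun i _ _ => sub_nonneg.2 (hwc i)
    have e3 : ∑ i, (w i - c) = ∑ i : Fin n with Fin.val i < k, p i - k * c := by
      rw [← sum_head_add_tail _ k]
      have : ∑ i : Fin n with k ≤ Fin.val i, (w i - c) = 0 :=
        Finset.sum_eq_zero fun i hi => by
          simp [hw, not_lt.2 (Finset.mem_filter.1 hi).2]
      rw [this, add_zero, Finset.sum_sub_distrib, Finset.sum_const,
        card_filter_lt (h.lt.trans hmn).le, nsmul_eq_mul]
      congr 1
      exact Finset.sum_congr rfl fun i hi => by simp [hw, (Finset.mem_filter.1 hi).2]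
    rw [← sum_head_add_tail p k, h.tail]
    linarith
  have hzero : ∀ y, w (a y) = 0 → push p f y = 0 := by
    intro y hy
    refine Finset.sum_eq_zero fun i _ => ?_
    split_ifs with hi
    · exact le_antisymm ((hpw i).trans (hy ▸ hawm y i hi)) (hp i)
    · rfl
  calc ∑ y, negMulLog (push p f y)
      ≤ ∑ y, (push p f y * -Real.log (w (a y)) + (w (a y) - push p f y)) :=
        Finset.sum_le_sum fun y _ => by
          rw [mul_neg]
          exact negMulLog_le_tangent (push_nonneg hp f y) (hc.trans (hwc _)) (hzero y)
    _ ≤ ∑ y, push p f y * -Real.log (w (a y)) := by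
        rw [Finset.sum_add_distrib, Finset.sum_sub_distrib, sum_push]
        linarith
    _ = ∑ i, p i * -Real.log (w (a (f i))) := sum_push_mul p f fun y => -Real.log (w (a y))
    _ ≤ ∑ i, p i * -Real.log (w i) := Finset.sum_le_sum fun i _ => by
        rcases (hp i).eq_or_lt with h0 | h0
        · simp [← h0]
        · exact mul_le_mul_of_nonneg_left (neg_le_neg (Real.log_le_log (h0.trans_le (hpw i))
            (hawm _ i rfl))) h0.le
    _ = _ := by
        rw [← sum_head_add_tail _ k]
        congr 1
        · refine Finset.sum_congr rfl fun i hi => ?_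
          simp [hw, (Finset.mem_filter.1 hi).2, negMulLog]
        · rw [negMulLog, neg_mul, mul_neg, ← mul_assoc, ← h.tail, Finset.sum_mul,
            ← Finset.sum_neg_distrib]
          refine Finset.sum_congr rfl fun i hi => ?_
          simp [hw, not_lt.2 (Finset.mem_filter.1 hi).2]

/-- A vector whose entries lie in `[y, 2 * y]` has almost the entropy of the constant vector. -/
theorem neg_mul_log_average_le {κ : Type*} (s : Finset κ) (hs : s.Nonempty) (q : κ → ℝ) {y : ℝ}
    (hy : 0 ≤ y) (h1 : ∀ a ∈ s, y ≤ q a) (h2 : ∀ a ∈ s, q a ≤ 2 * y) :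
    -((∑ a ∈ s, q a) * Real.log ((∑ a ∈ s, q a) / #s)) ≤
      ∑ a ∈ s, negMulLog (q a) + (∑ a ∈ s, q a) * (alpha * Real.log 2) := by
  rcases hy.eq_or_lt with rfl | hy
  · have : ∀ a ∈ s, q a = 0 := fun a ha => le_antisymm (by simpa using h2 a ha) (h1 a ha)
    rw [Finset.sum_eq_zero this, Finset.sum_eq_zero fun a ha => by rw [this a ha, negMulLog_zero]]
    simp
  have hN : (0 : ℝ) < #s := by exact_mod_cast hs.card_pos
  have hlog : 0 < Real.log 2 := Real.log_pos (by norm_num)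
  have hsum : ∑ a ∈ s, (-(q a * Real.log y) - 2 * (q a - y) * Real.log 2) ≤
      ∑ a ∈ s, negMulLog (q a) :=
    Finset.sum_le_sum fun a ha => chord_le_negMulLog hy (h1 a ha) (h2 a ha)
  have hS : 0 < ∑ a ∈ s, q a := Finset.sum_pos (fun a ha => hy.trans_le (h1 a ha)) hs
  rw [Finset.sum_sub_distrib, Finset.sum_neg_distrib, ← Finset.sum_mul, ← Finset.sum_mul,
    ← Finset.mul_sum, Finset.sum_sub_distrib, Finset.sum_const, nsmul_eq_mul] at hsum
  set S := ∑ a ∈ s, q a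
  have hu : 0 < y / (S / #s) := div_pos hy (div_pos hS hN)
  -- The tangent is taken where `y` over the average equals `1 / (2 * log 2)`, the worst case
  -- defining `alpha`.
  have ht := Real.log_le_sub_one_of_pos (mul_pos (mul_pos two_pos hlog) hu)
  rw [Real.log_mul (mul_pos two_pos hlog).ne' hu.ne',
    Real.log_div hy.ne' (div_pos hS hN).ne'] at ht
  have ht' := mul_le_mul_of_nonneg_left ht hS.le
  have he : S * (2 * Real.log 2 * (y / (S / #s)) - 1) = 2 * Real.log 2 * (#s * y) - S := by
    field_simp
  rw [he] at ht'
  rw [alpha_mul_log_two]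
  nlinarith

/-- An entropy maximizing function reaches the entropy of the flattening up to `alpha` bits. -/
theorem IsLevel.le_sum_negMulLog_push (h : IsLevel m p k c) (hmn : m < n) (hp : ∀ i, 0 ≤ p i)
    (hp1 : ∑ i, p i = 1)
    (hF : Fintype.card F = m) {f : Fin n → F} (hf : Function.Surjective f)
    (hmax : ∀ g : Fin n → F, Function.Surjective g →
      ∑ y, negMulLog (push p g y) ≤ ∑ y, negMulLog (push p f y)) :
    ∑ i : Fin n with Fin.val i < k, negMulLog (p i) + ((m : ℝ) - k) * negMulLog c ≤
      ∑ y, negMulLog (push p f y) + alpha * Real.log 2 := by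
  classical
  have hc := h.nonneg hp
  have hkm : (0 : ℝ) < (m : ℝ) - k := sub_pos.2 (by exact_mod_cast h.lt)
  have hne : (univ : Finset F).Nonempty := by
    rw [← Finset.card_pos, Finset.card_univ, hF]
    exact (Nat.zero_le k).trans_lt h.lt
  obtain ⟨b, -, hb⟩ := Finset.exists_min_image univ (push p f) hne
  set q := push p f with hq
  have hy : 0 ≤ q b := push_nonneg hp f b
  set I : Finset (Fin n) := {i | 2 * q b < p i} with hI
  set J : Finset (Fin n) := {i | (i : ℕ) < k} with hJ
  set L : Finset F := {a | 2 * q b < q a} with hL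
  have hpos : ∀ {i}, i ∈ I → 0 < p i := fun hi => by
    have := (Finset.mem_filter.1 hi).2
    linarith
  have hfI : ∀ {i}, i ∈ I → 2 * q b < q (f i) := fun {i} hi =>
    (Finset.mem_filter.1 hi).2.trans_le (le_push hp f i)
  have hqI : ∀ {i}, i ∈ I → q (f i) = p i := by
    intro i hi
    refine push_eq_of_forall_eq_zero fun j hj hji => ?_
    by_contra h0
    exact hj (eq_of_two_mul_push_lt hp hf hmax hji (hji ▸ hfI hi)
      ((hp j).lt_of_ne (Ne.symm h0)) (hpos hi))
  have hinj : Set.InjOn f I := fun i hi j hj hij =>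
    eq_of_two_mul_push_lt hp hf hmax hij (hfI hi) (hpos hi) (hpos hj)
  have hLI : L = I.image f := by
    ext a
    simp only [hL, Finset.mem_filter, Finset.mem_univ, true_and, Finset.mem_image]
    constructor
    · intro ha
      have : ∃ i, f i = a ∧ 0 < p i := by
        by_contra hcon
        push Not at hcon
        have : q a ≤ 0 := Finset.sum_nonpos fun i _ => by
          split_ifs with hi
          · exact hcon i hi
          · exact le_rfl
        linarith
      obtain ⟨i, rfl, hi⟩ := this
      have : q (f i) = p i := push_eq_of_forall_eq_zero fun j hj hji => by
        by_contra h0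
        exact hj (eq_of_two_mul_push_lt hp hf hmax hji (hji ▸ ha)
          ((hp j).lt_of_ne (Ne.symm h0)) hi)
      exact ⟨i, by simpa [hI, ← this] using ha, rfl⟩
    · rintro ⟨i, hi, rfl⟩
      exact hfI hi
  have hcard : #L = #I := by rw [hLI, Finset.card_image_of_injOn hinj]
  have hsumL : ∀ G : ℝ → ℝ, ∑ a ∈ L, G (q a) = ∑ i ∈ I, G (p i) := fun G => by
    rw [hLI, Finset.sum_image hinj]
    exact Finset.sum_congr rfl fun i hi => by rw [hqI hi]
  have hLc : ∀ {a}, a ∈ Lᶜ → q a ≤ 2 * q b := fun ha => by simpa [hL] using ha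
  have hLne : Lᶜ.Nonempty := ⟨b, by simp [hL]; linarith⟩
  have hN : (#Lᶜ : ℝ) = m - #I := by
    have h1 := Finset.card_compl_add_card L
    rw [hF, hcard] at h1
    rw [← h1]
    push_cast
    ring
  have hNpos : (0 : ℝ) < #Lᶜ := by exact_mod_cast hLne.card_pos
  set S := ∑ a ∈ Lᶜ, q a with hS
  have hSI : ∑ i ∈ I, p i + S = 1 := by
    rw [← hsumL fun t => t, ← hp1, ← sum_push p f]
    exact Finset.sum_add_sum_compl L q
  have hS0 : 0 ≤ S := Finset.sum_nonneg fun a _ => push_nonneg hp f a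
  have hS1 : S ≤ 1 := by
    have : 0 ≤ ∑ i ∈ I, p i := Finset.sum_nonneg fun i _ => hp i
    linarith
  have hJcard : #J = k := card_filter_lt (h.lt.trans hmn).le
  have hJsum : ∑ i ∈ J, p i + (m - k) * c = 1 := by
    rw [← h.tail, sum_head_add_tail, hp1]
  -- A heavy point outside the head forces `2 * q b < c`, hence `J ⊆ I`. The light fibres then weigh
  -- less than `(m - #I) * c`, while the mass outside `I` is at least that.
  have hIJ : I ⊆ J := by
    intro i hi
    by_contra hiJ
    have hic : p i ≤ c := h.le_level i (by simpa [hJ] using hiJ)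
    have hyc : 2 * q b < c := (Finset.mem_filter.1 hi).2.trans_le hic
    have hJI : J ⊆ I := fun j hj => by
      simpa [hI] using hyc.trans_le (h.level_le j (by simpa [hJ] using hj))
    have h1 : ∑ j ∈ I \ J, p j ≤ ∑ j ∈ I \ J, c := Finset.sum_le_sum fun j hj =>
      h.le_level j (by simpa [hJ] using (Finset.mem_sdiff.1 hj).2)
    have h2 : S ≤ ∑ a ∈ Lᶜ, 2 * q b := Finset.sum_le_sum fun a ha => hLc ha
    have h3 := Finset.sum_sdiff (f := p) hJI
    have h4 : (#(I \ J) : ℝ) + k = #I := by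
      rw [← hJcard]; exact_mod_cast Finset.card_sdiff_add_card_eq_card hJI
    rw [Finset.sum_const, nsmul_eq_mul] at h1 h2
    have h5 : (#Lᶜ : ℝ) * (2 * q b) < #Lᶜ * c := mul_lt_mul_of_pos_left hyc hNpos
    have h6 : (#(I \ J) : ℝ) = #I - k := by linarith
    rw [h6] at h1
    rw [hN] at h5 h2
    nlinarith
  have hIJcard : (#(J \ I) : ℝ) = k - #I := by
    have : (#(J \ I) : ℝ) + #I = k := by
      rw [← hJcard]; exact_mod_cast Finset.card_sdiff_add_card_eq_card hIJ
    linarith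
  -- The rest of the flattening has the mass and the number of entries of the light fibres, so both
  -- are compared with the same average `A`.
  have hIJsum : ∑ i ∈ J \ I, p i + (m - k) * c = S := by
    have := Finset.sum_sdiff (f := p) hIJ
    linarith
  set A := S / #Lᶜ with hA
  have hA0 : 0 ≤ A := div_nonneg hS0 hNpos.le
  have hAS : #Lᶜ * A = S := by rw [hA]; field_simp
  have hJI0 : 0 ≤ ∑ i ∈ J \ I, p i := Finset.sum_nonneg fun i _ => hp i
  have hSz : A = 0 → S = 0 := fun h0 => by rw [← hAS, h0, mul_zero]
  have hcz : A = 0 → c = 0 := fun h0 => by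
    have h1 := hSz h0
    nlinarith [mul_nonneg hkm.le hc]
  have hpz : A = 0 → ∀ i ∈ J \ I, p i = 0 := fun h0 => by
    have h1 := hSz h0
    have h2 : ∑ i ∈ J \ I, p i = 0 := by
      rw [hcz h0] at hIJsum
      linarith
    exact (Finset.sum_eq_zero_iff_of_nonneg fun i _ => hp i).1 h2
  have t1 : ∑ i ∈ J \ I, negMulLog (p i) ≤
      ∑ i ∈ J \ I, (-(p i * Real.log A) + (A - p i)) :=
    Finset.sum_le_sum fun i hi => negMulLog_le_tangent (hp i) hA0 fun h0 => hpz h0 i hi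
  have t2 := mul_le_mul_of_nonneg_left (negMulLog_le_tangent hc hA0 hcz) hkm.le
  rw [Finset.sum_add_distrib, Finset.sum_neg_distrib, ← Finset.sum_mul, Finset.sum_sub_distrib,
    Finset.sum_const, nsmul_eq_mul, hIJcard] at t1
  have t3 := neg_mul_log_average_le Lᶜ hLne q hy (fun a _ => hb a (Finset.mem_univ a))
    fun a ha => hLc ha
  rw [← hS, ← hA] at t3
  have t4 : S * (alpha * Real.log 2) ≤ alpha * Real.log 2 :=
    mul_le_of_le_one_left alpha_mul_log_two_nonneg hS1
  have t5 := Finset.sum_sdiff (f := fun i => negMulLog (p i)) hIJ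
  have t6 := Finset.sum_add_sum_compl L fun a => negMulLog (q a)
  rw [hsumL] at t6
  have t7 : (∑ i ∈ J \ I, p i) * Real.log A + (m - k) * c * Real.log A = S * Real.log A := by
    rw [← add_mul, hIJsum]
  rw [hN] at hAS
  nlinarith

end Level

/-! ### The flattening operator -/

theorem coord_succ {n : ℕ} (p : Fin n → ℝ) (i : Fin n) : coord p (i + 1) = p i := by
  have : 1 ≤ (i : ℕ) + 1 ∧ (i : ℕ) + 1 ≤ n := ⟨by omega, i.2⟩
  simp [coord, this]

theorem coord_of_lt {n : ℕ} (p : Fin n → ℝ) {i : ℕ} (h : i < n) : coord p (i + 1) = p ⟨i, h⟩ :=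
  coord_succ p ⟨i, h⟩

theorem tailSum_eq_sum_filter {n : ℕ} (p : Fin n → ℝ) (k : ℕ) :
    tailSum p k = ∑ i : Fin n with k ≤ Fin.val i, p i := by
  symm
  refine Finset.sum_bij (fun i _ => (i : ℕ) + 1) ?_ ?_ ?_ ?_
  · intro i hi
    have := (Finset.mem_filter.1 hi).2
    rw [Finset.mem_Icc]
    omega
  · intro i _ j _ hij
    exact Fin.ext (by omega)
  · intro j hj
    rw [Finset.mem_Icc] at hj
    exact ⟨⟨j - 1, by omega⟩, by simp; omega, by simp; omega⟩
  · intro i _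
    rw [coord_succ]

theorem tailSum_eq_add {n : ℕ} (p : Fin n → ℝ) {k : ℕ} (h : k < n) :
    tailSum p k = p ⟨k, h⟩ + tailSum p (k + 1) := by
  rw [tailSum, tailSum, ← Finset.add_sum_Ioc_eq_sum_Icc (by omega), coord_of_lt p h,
    ← Finset.Icc_add_one_left_eq_Ioc]

theorem tailSum_zero {n : ℕ} (p : Fin n → ℝ) : tailSum p 0 = ∑ i, p i := by
  simp [tailSum_eq_sum_filter]

/-- Failure of the defining inequality at `k + 1` rearranges to the next entry lying below the tail
average at `k`; thus maximality of the cut gives the level condition. -/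
theorem exists_isLevel {n m : ℕ} (hm : 2 ≤ m) (hmn : m < n) {p : Fin n → ℝ} (hanti : Antitone p)
    (hp : ∀ i, 0 ≤ p i) (hp1 : ∑ i, p i = 1) :
    ∃ k c, IsLevel m p k c ∧
      ∀ j : Fin m, flatten m p j = if (j : ℕ) < k then coord p (j + 1) else c := by
  have hm0 : (0 : ℝ) < m := by exact_mod_cast (by omega : 0 < m)
  have hc1 : coord p 1 = p ⟨0, by omega⟩ := coord_of_lt p (by omega : 0 < n)
  by_cases h1 : coord p 1 < 1 / (m : ℝ)
  · refine ⟨0, 1 / m, ⟨by omega, fun i hi => absurd hi (by omega), fun i _ => ?_, ?_⟩,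
      fun j => by rw [flatten, if_pos h1, if_neg (Nat.not_lt_zero _)]⟩
    · exact (hanti (Fin.mk_le_of_le_val (Nat.zero_le _))).trans (hc1 ▸ h1.le)
    · simp only [Nat.zero_le, Finset.filter_true, hp1]
      field_simp
      simp
  set k := cutIndex m p with hk
  -- Index 1 qualifies, so `cutIndex` is not the default 0.
  have hone : tailSum p 1 / ((m : ℝ) - (1 : ℕ)) ≤ coord p 1 := by
    have hm1 : (0 : ℝ) < (m : ℝ) - (1 : ℕ) := sub_pos.2 (by exact_mod_cast (by omega : 1 < m))
    have ht : p ⟨0, by omega⟩ + tailSum p 1 = 1 := by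
      rw [← tailSum_eq_add p (by omega : 0 < n), tailSum_zero, hp1]
    rw [not_lt, div_le_iff₀ hm0] at h1
    rw [div_le_iff₀ hm1]
    push_cast
    rw [← hc1] at ht
    linarith
  have hspec : tailSum p k / ((m : ℝ) - k) ≤ coord p k :=
    Nat.findGreatest_spec (P := fun i => tailSum p i / ((m : ℝ) - (i : ℝ)) ≤ coord p i)
      (by omega : 1 ≤ m - 1) hone
  have hk1 : 1 ≤ k := Nat.le_findGreatest (by omega) hone
  have hkm : k ≤ m - 1 := Nat.findGreatest_le _
  have hd : (0 : ℝ) < (m : ℝ) - k := sub_pos.2 (by exact_mod_cast (by omega : k < m))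
  have hkn : k < n := by omega
  have hnext : p ⟨k, hkn⟩ ≤ tailSum p k / ((m : ℝ) - k) := by
    rw [le_div_iff₀ hd, tailSum_eq_add p hkn]
    have ht : 0 ≤ tailSum p (k + 1) := by
      rw [tailSum_eq_sum_filter]; exact Finset.sum_nonneg fun i _ => hp i
    rcases hkm.eq_or_lt with h | h
    -- Maximality says nothing here, but the level is the whole tail, which contains the next entry.
    · have : (m : ℝ) = k + 1 := by exact_mod_cast (by omega : m = k + 1)
      rw [this]
      linarith
    · have hnot := Nat.findGreatest_is_greatest
        (P := fun i => tailSum p i / ((m : ℝ) - (i : ℝ)) ≤ coord p i)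
        (Nat.lt_succ_self k) (by omega : k + 1 ≤ m - 1)
      have hd' : (0 : ℝ) < (m : ℝ) - (k + 1 : ℕ) :=
        sub_pos.2 (by exact_mod_cast (by omega : k + 1 < m))
      rw [not_le, coord_of_lt p hkn, lt_div_iff₀ hd'] at hnot
      push_cast at hnot
      linarith
  refine ⟨k, tailSum p k / ((m : ℝ) - k), ⟨by omega, fun i hi => ?_, fun i hi => ?_, ?_⟩,
    fun j => by simp only [flatten, if_neg h1, Nat.add_one_le_iff, ← hk]⟩
  · refine hspec.trans ?_
    have : coord p k = p ⟨k - 1, by omega⟩ := by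
      rw [← coord_of_lt p, Nat.sub_add_cancel hk1]
    rw [this]
    exact hanti (Fin.le_def.2 (by simp; omega))
  · exact (hanti (Fin.le_def.2 hi)).trans hnext
  · rw [tailSum_eq_sum_filter]
    field_simp

theorem sum_range_ite_lt (G : ℕ → ℝ) (d : ℝ) {k m : ℕ} (h : k ≤ m) :
    ∑ j ∈ Finset.range m, (if j < k then G j else d) =
      ∑ j ∈ Finset.range k, G j + ((m : ℝ) - k) * d := by
  induction m, h using Nat.le_induction with
  | base =>
    rw [sub_self, zero_mul, add_zero]
    exact Finset.sum_congr rfl fun j hj => if_pos (Finset.mem_range.1 hj)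
  | succ m hm ih =>
    rw [Finset.sum_range_succ, ih, if_neg (by omega)]
    push_cast
    ring

theorem sum_fin_ite_lt {n m k : ℕ} (hkm : k ≤ m) (hkn : k ≤ n) (p : Fin n → ℝ) (G : ℝ → ℝ)
    (d : ℝ) :
    ∑ j : Fin m, (if (j : ℕ) < k then G (coord p (j + 1)) else d) =
      ∑ i : Fin n with Fin.val i < k, G (p i) + ((m : ℝ) - k) * d := by
  rw [Fin.sum_univ_eq_sum_range (fun j => if j < k then G (coord p (j + 1)) else d),
    sum_range_ite_lt _ _ hkm]
  congr 1
  have h := sum_range_ite_lt (fun j => G (coord p (j + 1))) 0 hkn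
  rw [mul_zero, add_zero] at h
  rw [← h, ← Fin.sum_univ_eq_sum_range (fun j => if j < k then G (coord p (j + 1)) else 0),
    Finset.sum_filter]
  exact Finset.sum_congr rfl fun i _ => by rw [coord_succ]

theorem IsLevel.sum_negMulLog_flatten {n m k : ℕ} {c : ℝ} {p : Fin n → ℝ} (h : IsLevel m p k c)
    (hmn : m < n)
    (hflat : ∀ j : Fin m, flatten m p j = if (j : ℕ) < k then coord p (j + 1) else c) :
    ∑ j, negMulLog (flatten m p j) =
      ∑ i : Fin n with Fin.val i < k, negMulLog (p i) + ((m : ℝ) - k) * negMulLog c := by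
  rw [← sum_fin_ite_lt h.lt.le (h.lt.trans hmn).le p negMulLog (negMulLog c)]
  refine Finset.sum_congr rfl fun j _ => ?_
  rw [hflat]
  split_ifs <;> rfl

/-! ### The merging operator -/

/-- The map which merges the first `n - m + 1` indices. -/
def mergeMap {n m : ℕ} (hm : 0 < m) (hmn : m < n) (i : Fin n) : Fin m :=
  -- Truncated subtraction sends exactly the 0-based indices up to `n - m` to 0.
  ⟨i - (n - m), by omega⟩

theorem mergeMap_surjective {n m : ℕ} (hm : 0 < m) (hmn : m < n) :
    Function.Surjective (mergeMap hm hmn) := fun j =>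
  ⟨⟨j + (n - m), by omega⟩, Fin.ext (by simp [mergeMap])⟩

theorem mergeTop_eq_push {n m : ℕ} (hm : 0 < m) (hmn : m < n) (p : Fin n → ℝ) :
    mergeTop m p = push p (mergeMap hm hmn) := by
  classical
  funext j
  by_cases hj : (j : ℕ) = 0
  · rw [mergeTop, if_pos hj, push_eq_sum_filter]
    symm
    refine Finset.sum_bij (fun i _ => (i : ℕ) + 1) ?_ ?_ ?_ ?_
    · intro i hi
      have := Fin.ext_iff.1 (Finset.mem_filter.1 hi).2
      simp only [mergeMap] at this
      rw [Finset.mem_Icc]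
      omega
    · intro i _ j _ hij
      exact Fin.ext (by omega)
    · intro l hl
      rw [Finset.mem_Icc] at hl
      exact ⟨⟨l - 1, by omega⟩, by simp [mergeMap, Fin.ext_iff]; omega, by simp; omega⟩
    · intro i _
      rw [coord_succ]
  · rw [mergeTop, if_neg hj, ← Nat.add_assoc, coord_of_lt p (by omega)]
    have hi : mergeMap hm hmn ⟨n - m + j, by omega⟩ = j := Fin.ext (by simp [mergeMap])
    have := push_eq_of_forall_eq_zero (p := p) (f := mergeMap hm hmn) (i := ⟨n - m + j, by omega⟩)
    rw [hi] at this
    refine (this fun i hne hij => absurd (Fin.ext ?_) hne).symm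
    have := Fin.ext_iff.1 hij
    simp only [mergeMap] at this ⊢
    omega

/-- The `d` later values of `s` need room above `s j`. -/
theorem strictMono_val_add_le {n r : ℕ} {s : Fin r → Fin n} (hs : StrictMono s) (d : ℕ) :
    ∀ j : Fin r, (j : ℕ) + d + 1 = r → (s j : ℕ) + d + 1 ≤ n := by
  induction d with
  | zero => intro j _; have := (s j).2; omega
  | succ d ih =>
    intro j hj
    have h1 := ih ⟨j + 1, by omega⟩ (by simp; omega)
    have h2 : (s j : ℕ) < s ⟨j + 1, by omega⟩ := hs (Fin.lt_def.2 (by simp))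
    omega

/-- Merging the largest masses minimizes the entropy. -/
theorem sum_negMulLog_mergeTop_le {n r : ℕ} (hrn : r + 1 < n) {p : Fin n → ℝ}
    (hanti : Antitone p) (hp : ∀ i, 0 ≤ p i) (hp1 : ∑ i, p i = 1) {F : Type*} [Fintype F]
    (hF : Fintype.card F = r + 1) {f : Fin n → F} (hf : Function.Surjective f) :
    ∑ j, negMulLog (mergeTop (r + 1) p j) ≤ ∑ y, negMulLog (push p f y) := by
  classical
  have hQpush := mergeTop_eq_push (Nat.succ_pos r) hrn p
  set Q := mergeTop (r + 1) p with hQ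
  set q := push p f with hq
  have hQ0 : ∀ j, 0 ≤ Q j := fun j => hQpush ▸ push_nonneg hp _ j
  have hQ1 : ∑ j, Q j = 1 := by rw [hQpush, sum_push, hp1]
  have hq1 : ∑ y, q y = 1 := by rw [hq, sum_push, hp1]
  have hq0 : ∀ y, 0 ≤ q y := push_nonneg hp f
  obtain ⟨y₀, -, hy₀⟩ := Finset.exists_max_image univ q
    (Finset.card_pos.1 (by rw [Finset.card_univ, hF]; omega))
  have hy₀pos : 0 < q y₀ := by
    by_contra hcon
    have : ∑ y, q y ≤ 0 := Finset.sum_nonpos fun y hy => (hy₀ y hy).trans (not_lt.1 hcon)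
    linarith
  obtain ⟨a, ha⟩ := hf.hasRightInverse
  have hcard : #((univ.erase y₀).image a) = r := by
    rw [Finset.card_image_of_injective _ ha.injective, Finset.card_erase_of_mem (Finset.mem_univ _),
      Finset.card_univ, hF, Nat.add_sub_cancel]
  -- Representatives of all fibres but the heaviest, in increasing order; `σ` lists the fibres
  -- accordingly, heaviest first.
  let s : Fin r ↪o Fin n := Finset.orderEmbOfFin _ hcard
  have hs : ∀ j, f (s j) ≠ y₀ ∧ a (f (s j)) = s j := fun j => by
    have hmem : s j ∈ (univ.erase y₀).image a := Finset.orderEmbOfFin_mem _ hcard j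
    obtain ⟨y, hy, hys⟩ := Finset.mem_image.1 hmem
    rw [← hys, ha y]
    exact ⟨Finset.ne_of_mem_erase hy, rfl⟩
  let σ : Fin (r + 1) → F := Fin.cons y₀ fun j => f (s j)
  have hσ : Function.Bijective σ := by
    rw [Fintype.bijective_iff_injective_and_card]
    refine ⟨Fin.cons_injective_iff.2 ⟨?_, fun i j hij => s.injective ?_⟩, by simp [hF]⟩
    · rintro ⟨j, hj⟩
      exact (hs j).1 hj
    · rw [← (hs i).2, ← (hs j).2]
      exact congrArg a hij
  have hQs : ∀ j : Fin r, Q j.succ ≤ p (s j) := fun j => by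
    have hlt : n - (r + 1) + ((j : ℕ) + 1) < n := by omega
    have : Q j.succ = p ⟨n - (r + 1) + ((j : ℕ) + 1), hlt⟩ := by
      rw [← coord_of_lt p hlt]
      simp [hQ, mergeTop, Nat.add_assoc]
    rw [this]
    refine hanti (Fin.le_def.2 ?_)
    have := strictMono_val_add_le s.strictMono (r - 1 - j) j (by omega)
    simp only
    omega
  have hzero : ∀ j, q (σ j) = 0 → Q j = 0 := by
    intro j
    refine Fin.cases ?_ (fun j => ?_) j
    · intro h; exact absurd h hy₀pos.ne'
    · intro h
      exact le_antisymm ((hQs j).trans ((le_push hp f (s j)).trans h.le)) (hQ0 _)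
  have hgibbs : ∑ j, negMulLog (Q j) ≤ -∑ j, Q j * Real.log (q (σ j)) := by
    have h1 : ∑ j, negMulLog (Q j) ≤ ∑ j, (-(Q j * Real.log (q (σ j))) + (q (σ j) - Q j)) :=
      Finset.sum_le_sum fun j _ => negMulLog_le_tangent (hQ0 j) (hq0 _) (hzero j)
    have h2 : ∑ j, q (σ j) = 1 := by rw [hσ.sum_comp q, hq1]
    rw [Finset.sum_add_distrib, Finset.sum_sub_distrib, Finset.sum_neg_distrib, h2, hQ1] at h1
    linarith
  have hneg : ∑ y, negMulLog (q y) = -∑ i, p i * Real.log (q (f i)) := by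
    rw [← sum_push_mul p f fun y => Real.log (q y), ← Finset.sum_neg_distrib]
    exact Finset.sum_congr rfl fun y _ => by rw [negMulLog, neg_mul]
  have hterm : ∀ i, p i * (Real.log (q (f i)) - Real.log (q y₀)) ≤ 0 := fun i => by
    rcases (hp i).eq_or_lt with h0 | h0
    · simp [← h0]
    · exact mul_nonpos_of_nonneg_of_nonpos h0.le (sub_nonpos.2
        (Real.log_le_log (h0.trans_le (le_push hp f i)) (hy₀ _ (Finset.mem_univ _))))
  have hsub : ∑ i, p i * (Real.log (q (f i)) - Real.log (q y₀)) ≤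
      ∑ j, p (s j) * (Real.log (q (f (s j))) - Real.log (q y₀)) := by
    have h := Finset.sum_le_sum_of_subset_of_nonneg
      (Finset.subset_univ (univ.map s.toEmbedding))
      (f := fun i => -(p i * (Real.log (q (f i)) - Real.log (q y₀))))
      fun i _ _ => neg_nonneg.2 (hterm i)
    rw [Finset.sum_map, Finset.sum_neg_distrib, Finset.sum_neg_distrib] at h
    exact neg_le_neg_iff.1 h
  have hcmp : ∑ j, p (s j) * (Real.log (q (f (s j))) - Real.log (q y₀)) ≤
      ∑ j : Fin r, Q j.succ * (Real.log (q (f (s j))) - Real.log (q y₀)) :=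
    Finset.sum_le_sum fun j _ => by
      -- An empty mass needs its own case: `log 0 = 0` can spoil the sign of the bracket, but both
      -- coefficients vanish.
      rcases (hq0 (f (s j))).eq_or_lt with h0 | h0
      · have h1 : p (s j) = 0 := le_antisymm ((le_push hp f (s j)).trans h0.ge) (hp _)
        have h2 : Q j.succ = 0 := le_antisymm (h1 ▸ hQs j) (hQ0 _)
        rw [h1, h2]
      · exact mul_le_mul_of_nonpos_right (hQs j) (sub_nonpos.2
          (Real.log_le_log h0 (hy₀ _ (Finset.mem_univ _))))
  have hl : ∑ i, p i * (Real.log (q (f i)) - Real.log (q y₀)) =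
      ∑ i, p i * Real.log (q (f i)) - Real.log (q y₀) := by
    simp only [mul_sub, Finset.sum_sub_distrib, ← Finset.sum_mul, hp1, one_mul]
  have hr : ∑ j : Fin r, Q j.succ * (Real.log (q (f (s j))) - Real.log (q y₀)) =
      ∑ j, Q j * Real.log (q (σ j)) - Real.log (q y₀) := by
    have h1 : ∑ j, Q j * (Real.log (q (σ j)) - Real.log (q y₀)) =
        ∑ j, Q j * Real.log (q (σ j)) - Real.log (q y₀) := by
      simp only [mul_sub, Finset.sum_sub_distrib, ← Finset.sum_mul, hQ1, one_mul]
    rw [← h1, Fin.sum_univ_succ]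
    simp [σ]
  linarith

/-! ### Laws of functions of a random variable -/

theorem law_comp_eq_push {Ω : Type*} [MeasurableSpace Ω] (P : MeasureTheory.Measure Ω)
    [MeasureTheory.IsProbabilityMeasure P] {E F : Type*} [MeasurableSpace E]
    [MeasurableSingletonClass E] {n : ℕ} (x : Fin n ≃ E) {X : Ω → E} (hX : Measurable X)
    {p : Fin n → ℝ} (hp : ∀ i, law P X (x i) = p i) (f : E → F) :
    law P (f ∘ X) = push p (f ∘ x) := by
  classical
  funext y
  have hset : (f ∘ X) ⁻¹' {y} =
      ⋃ i ∈ ({i | f (x i) = y} : Finset (Fin n)), X ⁻¹' {x i} := by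
    ext ω
    simp only [Set.mem_preimage, Function.comp_apply, Set.mem_singleton_iff, Finset.mem_filter,
      Finset.mem_univ, true_and, Set.mem_iUnion, exists_prop]
    constructor
    · intro h
      exact ⟨x.symm (X ω), by simpa using h, by simp⟩
    · rintro ⟨i, hi, hω⟩
      rw [hω, hi]
  rw [law, hset, MeasureTheory.measureReal_biUnion_finset]
  · rw [push_eq_sum_filter]
    exact Finset.sum_congr rfl fun i _ => hp i
  · intro i _ j _ hij
    refine Set.disjoint_left.2 fun ω hi hj => hij (x.injective ?_)
    rw [← Set.mem_singleton_iff.1 hi, Set.mem_singleton_iff.1 hj]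
  · intro i _
    exact hX (measurableSet_singleton _)

/-- The entropies of the images of `X` in terms of the sorted vector of its masses. -/
theorem mem_imageEntropies_iff {Ω : Type*} [MeasurableSpace Ω] (P : MeasureTheory.Measure Ω)
    [MeasureTheory.IsProbabilityMeasure P] {E F : Type*} [MeasurableSpace E]
    [MeasurableSingletonClass E] [Fintype F] {n : ℕ} (x : Fin n ≃ E) {X : Ω → E}
    (hX : Measurable X) {p : Fin n → ℝ} (hp : ∀ i, law P X (x i) = p i) (h : ℝ) :
    h ∈ imageEntropies P X F ↔
      ∃ g : Fin n → F, Function.Surjective g ∧ h = entropy (push (decr p) g) := by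
  set e := Tuple.sort (OrderDual.toDual ∘ p) with he
  constructor
  · rintro ⟨f, hf, rfl⟩
    refine ⟨(f ∘ x) ∘ e, (hf.comp x.surjective).comp e.surjective, ?_⟩
    rw [law_comp_eq_push P x hX hp, decr, ← he, push_comp_perm]
  · rintro ⟨g, hg, rfl⟩
    refine ⟨(g ∘ e.symm) ∘ x.symm, (hg.comp e.symm.surjective).comp x.symm.surjective, ?_⟩
    rw [law_comp_eq_push P x hX hp, decr, ← he, ← push_comp_perm p _ e]
    congr 2
    funext i
    simp

theorem sum_law_eq_one {Ω : Type*} [MeasurableSpace Ω] (P : MeasureTheory.Measure Ω)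
    [MeasureTheory.IsProbabilityMeasure P] {E : Type*} [MeasurableSpace E]
    [MeasurableSingletonClass E] {n : ℕ} (x : Fin n ≃ E) {X : Ω → E} (hX : Measurable X)
    {p : Fin n → ℝ} (hp : ∀ i, law P X (x i) = p i) : ∑ i, p i = 1 := by
  have h := congrFun (law_comp_eq_push P x hX hp fun _ => ()) ()
  have h1 : law P ((fun _ => ()) ∘ X) () = 1 := by
    have : ((fun _ => ()) ∘ X) ⁻¹' {()} = Set.univ := by ext; simp
    rw [law, this, MeasureTheory.probReal_univ]
  rw [← h1, h]
  simp [push]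

end EntropyOfFunction

end

theorem theorem1 {Ω : Type*} [MeasurableSpace Ω] (P : MeasureTheory.Measure Ω)
    [MeasureTheory.IsProbabilityMeasure P]
    {E : Type*} [MeasurableSpace E] [MeasurableSingletonClass E]
    {F : Type*} [Fintype F]
    (n m : ℕ) (hm : 2 ≤ m) (hmn : m < n)
    (x : Fin n ≃ E) (hF : Fintype.card F = m)
    (X : Ω → E) (hX : Measurable X)
    (p : Fin n → ℝ) (hp : ∀ i, EntropyOfFunction.law P X (x i) = p i) :
    EntropyOfFunction.alpha < 0.0861 ∧
    (∃ M : ℝ, IsGreatest (EntropyOfFunction.imageEntropies P X F) M ∧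
      M ∈ Set.Icc
        (EntropyOfFunction.entropy (EntropyOfFunction.flatten m (EntropyOfFunction.decr p))
          - EntropyOfFunction.alpha)
        (EntropyOfFunction.entropy (EntropyOfFunction.flatten m (EntropyOfFunction.decr p)))) ∧
    IsLeast (EntropyOfFunction.imageEntropies P X F)
      (EntropyOfFunction.entropy
        (EntropyOfFunction.mergeTop m (EntropyOfFunction.decr p))) := by
  open EntropyOfFunction in
  have hanti := decr_antitone p
  have hmem := mem_imageEntropies_iff (F := F) P x hX hp
  have hnn : ∀ i, 0 ≤ decr p i := fun i => by
    rw [decr, Function.comp_apply, ← hp]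
    exact MeasureTheory.measureReal_nonneg
  have hsum : ∑ i, decr p i = 1 := by
    rw [← sum_law_eq_one P x hX hp]
    exact Equiv.sum_comp (Tuple.sort (OrderDual.toDual ∘ p)) p
  have hlog : 0 < Real.log 2 := Real.log_pos (by norm_num)
  have e : Fin m ≃ F := (Fintype.equivFinOfCardEq hF).symm
  have hm0 : 0 < m := by omega
  have hmerge : Function.Surjective (e ∘ mergeMap hm0 hmn) :=
    e.surjective.comp (mergeMap_surjective hm0 hmn)
  refine ⟨alpha_lt, ?_, ?_, ?_⟩
  · obtain ⟨f, hf, hmax⟩ := Set.exists_max_image {f : Fin n → F | Function.Surjective f}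
      (fun f => ∑ y, Real.negMulLog (push (decr p) f y)) (Set.toFinite _) ⟨_, hmerge⟩
    obtain ⟨k, c, hlevel, hflat⟩ := exists_isLevel hm hmn hanti hnn hsum
    refine ⟨entropy (push (decr p) f), ⟨(hmem _).2 ⟨f, hf, rfl⟩, fun h hh => ?_⟩, ?_, ?_⟩
    · obtain ⟨g, hg, rfl⟩ := (hmem h).1 hh
      rw [entropy_eq_sum_negMulLog, entropy_eq_sum_negMulLog]
      exact div_le_div_of_nonneg_right (hmax g hg) hlog.le
    · rw [entropy_eq_sum_negMulLog, entropy_eq_sum_negMulLog, sub_le_iff_le_add,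
        div_le_iff₀ hlog, add_mul, div_mul_cancel₀ _ hlog.ne',
        hlevel.sum_negMulLog_flatten hmn hflat]
      exact hlevel.le_sum_negMulLog_push hmn hnn hsum hF hf hmax
    · rw [entropy_eq_sum_negMulLog, entropy_eq_sum_negMulLog]
      refine div_le_div_of_nonneg_right ?_ hlog.le
      rw [hlevel.sum_negMulLog_flatten hmn hflat]
      exact hlevel.sum_negMulLog_push_le hmn hnn hF hf
  · refine (hmem _).2 ⟨_, hmerge, ?_⟩
    rw [entropy_eq_sum_negMulLog, entropy_eq_sum_negMulLog, mergeTop_eq_push hm0 hmn,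
      ← Equiv.sum_comp e]
    simp only [push_comp_equiv]
  · intro h hh
    obtain ⟨g, hg, rfl⟩ := (hmem h).1 hh
    rw [entropy_eq_sum_negMulLog, entropy_eq_sum_negMulLog]
    refine div_le_div_of_nonneg_right ?_ hlog.le
    obtain ⟨r, rfl⟩ : ∃ r, m = r + 1 := ⟨m - 1, by omega⟩
    exact sum_negMulLog_mergeTop_le hmn hanti hnn hsum hF hg
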